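/- Let $n\ge 2$. Define the generalized cross product $a\times_n b\in\mathbb{R}^{n(n-1)/2}$ of $a,b\in\mathbb{R}^n$ inductively by $a\times_2 b=a_1b_2-a_2b_1$ and, writing $a=(\bar a,a_n)$, $b=(\bar b,b_n)$ with $\bar a,\bar b\in\mathbb{R}^{n-1}$, $$a\times_n b=\begin{pmatrix}\bar a\times_{n-1}\bar b\\ b_n\,\bar a-a_n\,\bar b\end{pmatrix}\qquad(n\ge 3),$$ and let $M_a\in\mathbb{R}^{\frac{n(n-1)}2\times n}$ be the matrix with $M_a b=a\times_n b$ for all $b\in\mathbb{R}^n$. Let $e_1,\dots,e_n$ be the standard basis of $\mathbb{R}^n$, and define, for smooth $a:\mathbb{R}^n\to\mathbb{R}^n$ and $w:\mathbb{R}^n\to\mathbb{R}^{n(n-1)/2}$, $$\operatorname{div}a=\sum_{i=1}^n\partial_i a_i,\qquad \operatorname{curl}_n a=M_\nabla a=\sum_{i=1}^n M_{e_i}\,\partial_i a,\qquad M_\nabla^T w=\sum_{i=1}^n M_{e_i}^T\,\partial_i w .$$ Let $\omega_n$ be the volume of the unit ball of $\mathbb{R}^n$ and let $$G(x,y)=\frac1{2\pi}\ln|x-y|\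 \ (n=2),\qquad G(x,y)=\frac{1}{n(2-n)\omega_n}|x-y|^{2-n}\ \ (n\ge3).$$ Then every $a\in C_c^\infty(\mathbb{R}^n,\mathbb{R}^n)$ can be written as $a=a_{\mathrm{curl}}+a_{\mathrm{div}}$ with smooth vector fields $a_{\mathrm{curl}},a_{\mathrm{div}}$ on $\mathbb{R}^n$ such that $\operatorname{curl}_n a_{\mathrm{curl}}=0$ and $\operatorname{div}a_{\mathrm{div}}=0$, and these are given explicitly, for all $x\in\mathbb{R}^n$, by $$a_{\mathrm{curl}}(x)=\nabla_x\int_{\mathbb{R}^n}G(x,y)\,\operatorname{div}a(y)\,dy=\frac1{n\omega_n}\int_{\mathbb{R}^n}(x-y)\,|x-y|^{-n}\operatorname{div}a(y)\,dy,$$ $$a_{\mathrm{div}}(x)=M_{\nabla_x}^T\int_{\mathbb{R}^n}G(x,y)\,\operatorname{curl}_n a(y)\,dy=\frac1{n\omega_n}\int_{\mathbb{R}^n}M_{x-y}^T\bigl(|x-y|^{-n}\operatorname{curl}_n a(y)\bigr)\,dy,$$ where all the integrals converge absolutely and the two integrals containing $G$ are smooth functions of $x$. -/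

import Mathlib

open scoped ContDiff

noncomputable section

namespace Helmholtz

/-- The number of components of the generalized cross product on `ℝⁿ`, in the recursive form
that fits the inductive definition below; it equals `n (n - 1) / 2`, see `crossDim_eq`. -/
def crossDim : ℕ → ℕ
  | 0 => 0
  | n + 1 => crossDim n + n

theorem crossDim_eq (n : ℕ) : crossDim n = n * (n - 1) / 2 := by
  rw [← Nat.choose_two_right]
  induction n with
  | zero => rfl
  | succ k ih =>
    rw [crossDim, ih, Nat.choose_succ_succ' k 1, Nat.choose_one_right, Nat.add_comm]

/-- The generalized cross product `a ×ₙ b`, by induction on the dimension: writing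
`a = (a', α)` and `b = (b', β)` with last coordinates `α`, `β`, the product is the column
`(a' × b', β a' - α b')`. In dimensions `0` and `1` it has no components, and in dimension `2`
its only component is `a₁ b₂ - a₂ b₁`. -/
def genCross : (n : ℕ) → (Fin n → ℝ) → (Fin n → ℝ) → (Fin (crossDim n) → ℝ)
  | 0, _, _ => fun _ => 0
  | n + 1, a, b =>
    Fin.append (genCross n (Fin.init a) (Fin.init b))
      (b (Fin.last n) • Fin.init a - a (Fin.last n) • Fin.init b)

/-- The matrix `M_a` of size `n (n - 1) / 2 × n` of the linear map `b ↦ a ×ₙ b`: its `j`-th column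
is `a ×ₙ e_j`. -/
def crossMat (n : ℕ) (a : Fin n → ℝ) : Matrix (Fin (crossDim n)) (Fin n) ℝ :=
  Matrix.of fun k j => genCross n a (Pi.single j 1) k

theorem genCross_castAdd (n : ℕ) (a b : Fin (n + 1) → ℝ) (i : Fin (crossDim n)) :
    genCross (n + 1) a b (Fin.castAdd n i) = genCross n (Fin.init a) (Fin.init b) i :=
  Fin.append_left _ _ i

theorem genCross_natAdd (n : ℕ) (a b : Fin (n + 1) → ℝ) (i : Fin n) :
    genCross (n + 1) a b (Fin.natAdd (crossDim n) i) =
      b (Fin.last n) * a i.castSucc - a (Fin.last n) * b i.castSucc :=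
  Fin.append_right _ _ i

theorem genCross_add (n : ℕ) (a b c : Fin n → ℝ) :
    genCross n a (b + c) = genCross n a b + genCross n a c := by
  induction n with
  | zero => funext k; exact k.elim0
  | succ n ih =>
    funext k
    refine Fin.addCases (fun i => ?_) (fun i => ?_) k
    · exact (genCross_castAdd n a (b + c) i).trans
        ((congrFun (ih (Fin.init a) (Fin.init b) (Fin.init c)) i).trans
          (congrArg₂ (· + ·) (genCross_castAdd n a b i).symm (genCross_castAdd n a c i).symm))
    · refine (genCross_natAdd n a (b + c) i).trans (Eq.trans ?_
          (congrArg₂ (· + ·) (genCross_natAdd n a b i).symm (genCross_natAdd n a c i).symm))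
      simp only [Pi.add_apply]
      ring

theorem genCross_smul (n : ℕ) (a : Fin n → ℝ) (r : ℝ) (b : Fin n → ℝ) :
    genCross n a (r • b) = r • genCross n a b := by
  induction n with
  | zero => funext k; exact k.elim0
  | succ n ih =>
    funext k
    refine Fin.addCases (fun i => ?_) (fun i => ?_) k
    · exact (genCross_castAdd n a (r • b) i).trans
        ((congrFun (ih (Fin.init a) (Fin.init b)) i).trans
          (congrArg (r * ·) (genCross_castAdd n a b i).symm))
    · refine (genCross_natAdd n a (r • b) i).trans (Eq.trans ?_
          (congrArg (r * ·) (genCross_natAdd n a b i).symm))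
      simp only [Pi.smul_apply, smul_eq_mul]
      ring

/-- The defining property of the matrix `M_a`. -/
theorem crossMat_mulVec (n : ℕ) (a b : Fin n → ℝ) :
    (crossMat n a).mulVec b = genCross n a b := by
  let L : (Fin n → ℝ) →ₗ[ℝ] (Fin (crossDim n) → ℝ) :=
    { toFun := genCross n a
      map_add' := genCross_add n a
      map_smul' := genCross_smul n a }
  have hL : crossMat n a = LinearMap.toMatrix' L := by
    ext k j
    simp [crossMat, LinearMap.toMatrix'_apply, L]
  rw [hL, LinearMap.toMatrix'_mulVec]
  rfl

/-- The matrix-vector product `M_b v` as a map of Euclidean spaces. -/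
def crossMul {n : ℕ} (b v : EuclideanSpace ℝ (Fin n)) :
    EuclideanSpace ℝ (Fin (crossDim n)) :=
  WithLp.toLp 2 ((crossMat n b.ofLp).mulVec v.ofLp)

/-- The matrix-vector product `M_bᵀ w` as a map of Euclidean spaces. -/
def crossMulT {n : ℕ} (b : EuclideanSpace ℝ (Fin n))
    (w : EuclideanSpace ℝ (Fin (crossDim n))) : EuclideanSpace ℝ (Fin n) :=
  WithLp.toLp 2 ((crossMat n b.ofLp).transpose.mulVec w.ofLp)

/-- The partial derivative `∂_i f (x)`. -/
def partialD {n : ℕ} {F : Type*} [NormedAddCommGroup F] [NormedSpace ℝ F] (i : Fin n)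
    (f : EuclideanSpace ℝ (Fin n) → F) (x : EuclideanSpace ℝ (Fin n)) : F :=
  fderiv ℝ f x (EuclideanSpace.single i 1)

/-- The divergence of a vector field, `∑ᵢ ∂ᵢ aᵢ`. -/
def vdiv {n : ℕ} (a : EuclideanSpace ℝ (Fin n) → EuclideanSpace ℝ (Fin n))
    (x : EuclideanSpace ℝ (Fin n)) : ℝ :=
  ∑ i, (partialD i a x) i

/-- The generalized curl `M_∇ a = ∇ ×ₙ a`. Since `M_b` is linear in `b`, inserting
`∇ = ∑ᵢ eᵢ ∂ᵢ` for `b` gives `∑ᵢ M_{eᵢ} ∂ᵢ a`. -/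
def ncurl {n : ℕ} (a : EuclideanSpace ℝ (Fin n) → EuclideanSpace ℝ (Fin n))
    (x : EuclideanSpace ℝ (Fin n)) : EuclideanSpace ℝ (Fin (crossDim n)) :=
  ∑ i, crossMul (EuclideanSpace.single i 1) (partialD i a x)

/-- The differential operator `M_∇ᵀ`, that is `∑ᵢ M_{eᵢ}ᵀ ∂ᵢ`. -/
def ncurlT {n : ℕ} (w : EuclideanSpace ℝ (Fin n) → EuclideanSpace ℝ (Fin (crossDim n)))
    (x : EuclideanSpace ℝ (Fin n)) : EuclideanSpace ℝ (Fin n) :=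
  ∑ i, crossMulT (EuclideanSpace.single i 1) (partialD i w x)

/-- The volume `ω_n` of the unit ball of `ℝⁿ`. -/
def ballVol (n : ℕ) : ℝ :=
  (MeasureTheory.volume (Metric.ball (0 : EuclideanSpace ℝ (Fin n)) 1)).toReal

/-- The normalized fundamental solution `G(x, y)` of the Laplacian on `ℝⁿ`, `n ≥ 2`. -/
def green {n : ℕ} (x y : EuclideanSpace ℝ (Fin n)) : ℝ :=
  if n = 2 then 1 / (2 * Real.pi) * Real.log ‖x - y‖
  else 1 / ((n : ℝ) * (2 - (n : ℝ)) * ballVol n) * ‖x - y‖ ^ (2 - (n : ℤ))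

end Helmholtz

end

/-!
The proof rests on the Newtonian potential `N f x = ∫ G(x, y) f(y) dy` of a smooth density `f` with
compact support. It has three properties.

* `N` commutes with differentiation (`fderiv_potential`), being the convolution with a locally
  integrable kernel; in particular `N f` is smooth, `N (div a) = div (N a)` and
  `N (curl a) = curl (N a)` (`diffOp_potential`).
* A derivative falling on `f` can be moved to the fundamental solution
  (`integral_green_smul_fderiv`): `∂ᵢ N f` is, up to the factor `1 / (n ω_n)`, the integral of
  `(x - y)ᵢ |x - y|⁻ⁿ f(y)`. The kernel is made smooth by adding `δ > 0` to the squared distance,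
  the integration by parts is carried out there, and `δ → 0` by dominated convergence. This gives
  the second formula for each of the two fields (`diffOp_potential_eq_integral`).
* `Δ (N f) = f` (`laplacian_potential`). By the previous points `Δ (N f) (x)` is the integral of
  `Df(y) (x - y) |x - y|⁻ⁿ`, divided by `n ω_n`. In polar coordinates centred at `x` this is the
  integral over the unit sphere, of area `n ω_n`, of `-∫ (d/dr) f(x - r s) dr = f(x)`
  (`integral_fderiv_gradKernel`).

The remaining part is algebra. The Binet–Cauchy identity for the generalized cross product
(`sum_genCross_mul_genCross`) says `M_vᵀ M_v w = |v|² w - (v · w) v`, and since second derivatives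
are symmetric it turns into `∇ div + M_∇ᵀ M_∇ = Δ` (`gradient_vdiv_add_ncurlT_ncurl`). Applied to
`N a`, it exhibits `a = Δ (N a)` as the sum of `∇ N (div a)` and `M_∇ᵀ N (curl a)`. The first
field is curl-free and the second divergence-free because the cross product is antisymmetric
(`ncurl_gradient`, `vdiv_ncurlT`).
-/

namespace Helmholtz

open MeasureTheory Set Filter Topology Metric

/-! ### Algebra of the generalized cross product -/

theorem genCross_antisymm (n : ℕ) (a b : Fin n → ℝ) : genCross n a b = -genCross n b a := by
  induction n with
  | zero => funext k; exact k.elim0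
  | succ n ih =>
    funext k
    refine Fin.addCases (fun i => ?_) (fun i => ?_) k
    · exact (genCross_castAdd n a b i).trans ((congrFun (ih (Fin.init a) (Fin.init b)) i).trans
        (congrArg (- ·) (genCross_castAdd n b a i).symm))
    · refine (genCross_natAdd n a b i).trans (Eq.trans ?_
        (congrArg (- ·) (genCross_natAdd n b a i).symm))
      ring

/-- The Binet–Cauchy identity for the generalized cross product. -/
theorem sum_genCross_mul_genCross (n : ℕ) (a b c d : Fin n → ℝ) :
    ∑ k, genCross n a b k * genCross n c d k =
      (∑ i, a i * c i) * (∑ i, b i * d i) - (∑ i, a i * d i) * (∑ i, b i * c i) := by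
  induction n with
  | zero =>
    refine (Finset.sum_eq_zero fun k _ => k.elim0).trans ?_
    simp
  | succ n ih =>
    have h : ∑ k : Fin (crossDim n + n), genCross (n + 1) a b k * genCross (n + 1) c d k =
        ∑ k, genCross n (Fin.init a) (Fin.init b) k * genCross n (Fin.init c) (Fin.init d) k +
        ∑ i : Fin n, (b (Fin.last n) * a i.castSucc - a (Fin.last n) * b i.castSucc) *
          (d (Fin.last n) * c i.castSucc - c (Fin.last n) * d i.castSucc) := by
      rw [Fin.sum_univ_add]
      refine congrArg₂ (· + ·) (Finset.sum_congr rfl fun i _ => ?_)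
        (Finset.sum_congr rfl fun i _ => ?_)
      · exact congrArg₂ (· * ·) (genCross_castAdd n a b i) (genCross_castAdd n c d i)
      · exact congrArg₂ (· * ·) (genCross_natAdd n a b i) (genCross_natAdd n c d i)
    refine Eq.trans h ?_
    have h2 : ∀ i : Fin n, (b (Fin.last n) * a i.castSucc - a (Fin.last n) * b i.castSucc) *
          (d (Fin.last n) * c i.castSucc - c (Fin.last n) * d i.castSucc) =
        b (Fin.last n) * d (Fin.last n) * (a i.castSucc * c i.castSucc)
        - b (Fin.last n) * c (Fin.last n) * (a i.castSucc * d i.castSucc)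
        - a (Fin.last n) * d (Fin.last n) * (b i.castSucc * c i.castSucc)
        + a (Fin.last n) * c (Fin.last n) * (b i.castSucc * d i.castSucc) := fun i => by ring
    simp only [ih, h2, Fin.sum_univ_castSucc, Finset.sum_add_distrib, Finset.sum_sub_distrib,
      ← Finset.mul_sum, Fin.init]
    ring

variable {n : ℕ}

theorem crossMul_apply (b v : EuclideanSpace ℝ (Fin n)) (k : Fin (crossDim n)) :
    crossMul b v k = genCross n b.ofLp v.ofLp k :=
  congrFun (crossMat_mulVec n b.ofLp v.ofLp) k

theorem crossMul_antisymm (b v : EuclideanSpace ℝ (Fin n)) : crossMul b v = -crossMul v b := by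
  ext k
  simp only [PiLp.neg_apply, crossMul_apply]
  exact congrFun (genCross_antisymm n _ _) k

theorem crossMul_add_right (b v w : EuclideanSpace ℝ (Fin n)) :
    crossMul b (v + w) = crossMul b v + crossMul b w := by
  ext k
  simp only [PiLp.add_apply, crossMul_apply]
  exact congrFun (genCross_add n _ _ _) k

theorem crossMul_smul_right (r : ℝ) (b v : EuclideanSpace ℝ (Fin n)) :
    crossMul b (r • v) = r • crossMul b v := by
  ext k
  simp only [PiLp.smul_apply, crossMul_apply]
  exact congrFun (genCross_smul n _ _ _) k

/-- The generalized cross product as a continuous bilinear map. -/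
noncomputable def crossMulL (n : ℕ) : EuclideanSpace ℝ (Fin n) →L[ℝ] EuclideanSpace ℝ (Fin n) →L[ℝ]
    EuclideanSpace ℝ (Fin (crossDim n)) :=
  LinearMap.toContinuousBilinearMap <| LinearMap.mk₂ ℝ crossMul
    (fun a b c => by
      rw [crossMul_antisymm, crossMul_add_right, neg_add, ← crossMul_antisymm,
        ← crossMul_antisymm])
    (fun r a b => by
      rw [crossMul_antisymm, crossMul_smul_right, ← smul_neg, ← crossMul_antisymm])
    crossMul_add_right crossMul_smul_right

@[simp]
theorem crossMulL_apply (b v : EuclideanSpace ℝ (Fin n)) : crossMulL n b v = crossMul b v := rfl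

/-- `M_bᵀ` is the adjoint of `M_b`. -/
theorem inner_crossMulT (b v : EuclideanSpace ℝ (Fin n))
    (w : EuclideanSpace ℝ (Fin (crossDim n))) :
    inner ℝ (crossMulT b w) v = inner ℝ w (crossMul b v) := by
  simp only [EuclideanSpace.inner_eq_star_dotProduct, crossMulT, crossMul, star_trivial]
  rw [Matrix.dotProduct_mulVec, Matrix.vecMul_transpose]

/-- The map `(b, w) ↦ M_bᵀ w` as a continuous bilinear map. -/
noncomputable def crossMulTL (n : ℕ) : EuclideanSpace ℝ (Fin n) →L[ℝ]
    EuclideanSpace ℝ (Fin (crossDim n)) →L[ℝ] EuclideanSpace ℝ (Fin n) :=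
  LinearMap.toContinuousBilinearMap <| LinearMap.mk₂ ℝ crossMulT
    (fun a b c => ext_inner_right ℝ fun v => by
      simp only [inner_add_left, inner_crossMulT, ← crossMulL_apply, map_add,
        add_apply, inner_add_right])
    (fun r a b => ext_inner_right ℝ fun v => by
      simp only [inner_smul_left, inner_crossMulT, ← crossMulL_apply, map_smul,
        smul_apply, inner_smul_right, conj_trivial])
    (fun a b c => ext_inner_right ℝ fun v => by
      simp only [inner_add_left, inner_crossMulT])
    (fun r a b => ext_inner_right ℝ fun v => by
      simp only [inner_smul_left, inner_crossMulT])

@[simp]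
theorem crossMulTL_apply (b : EuclideanSpace ℝ (Fin n))
    (w : EuclideanSpace ℝ (Fin (crossDim n))) : crossMulTL n b w = crossMulT b w := rfl

/-- The double product `M_cᵀ M_a b`, the analogue of the expansion of `c × (a × b)`. -/
theorem crossMulT_crossMul (a b c : EuclideanSpace ℝ (Fin n)) :
    crossMulT c (crossMul a b) = inner ℝ a c • b - inner ℝ b c • a := by
  refine ext_inner_right ℝ fun d => ?_
  rw [inner_crossMulT, inner_sub_left, inner_smul_left, inner_smul_left]
  simp only [PiLp.inner_apply, crossMul_apply, conj_trivial, RCLike.inner_apply]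
  have := sum_genCross_mul_genCross n a.ofLp b.ofLp c.ofLp d.ofLp
  simp only [mul_comm] at this ⊢
  linarith

/-! ### Integration in polar coordinates -/

section Polar

variable {E F : Type*} [NormedAddCommGroup E] [NormedSpace ℝ E] [FiniteDimensional ℝ E]
  [MeasurableSpace E] [BorelSpace E] [Nontrivial E] [NormedAddCommGroup F] [NormedSpace ℝ F]
  (μ : Measure E) [μ.IsAddHaarMeasure]

/-- Polar coordinates for functions that need not be radial. -/
theorem integral_eq_integral_toSphere_integral_Ioi {g : E → F} (hg : Integrable g μ) :
    ∫ x, g x ∂μ = ∫ s, (∫ r in Ioi (0 : ℝ), r ^ (Module.finrank ℝ E - 1) • g (r • (s : E)))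
      ∂μ.toSphere := by
  have hemb : MeasurableEmbedding (homeomorphUnitSphereProd E) :=
    (homeomorphUnitSphereProd E).measurableEmbedding
  have hmp := μ.measurePreserving_homeomorphUnitSphereProd
  have hinv : ∀ x : ({0}ᶜ : Set E), (((homeomorphUnitSphereProd E x).2 : ℝ) •
      ((homeomorphUnitSphereProd E x).1 : E)) = x := fun x =>
    congrArg Subtype.val ((homeomorphUnitSphereProd E).symm_apply_apply x)
  have hint : Integrable (fun p : sphere (0 : E) 1 × Ioi (0 : ℝ) => g ((p.2 : ℝ) • (p.1 : E)))
      (μ.toSphere.prod (.volumeIoiPow (Module.finrank ℝ E - 1))) := by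
    rw [← hmp.integrable_comp_emb hemb]
    simp only [Function.comp_def, hinv]
    rw [← Function.comp_def g,
      ← integrableOn_iff_comap_subtypeVal (measurableSet_singleton _).compl]
    exact hg.integrableOn
  calc
    ∫ x, g x ∂μ = ∫ x : ({0}ᶜ : Set E), g x ∂(μ.comap (↑)) := by
      rw [integral_subtype_comap (measurableSet_singleton _).compl, restrict_compl_singleton]
    _ = ∫ p, g ((p.2 : ℝ) • (p.1 : E))
          ∂μ.toSphere.prod (.volumeIoiPow (Module.finrank ℝ E - 1)) := by
      rw [← hmp.integral_comp hemb]
      simp only [hinv]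
    _ = _ := by
      rw [integral_prod _ hint]
      refine integral_congr_ae (Eventually.of_forall fun s => ?_)
      simp only [Measure.volumeIoiPow, ENNReal.ofReal]
      rw [integral_withDensity_eq_integral_smul, integral_subtype_comap measurableSet_Ioi
          fun a : ℝ ↦ Real.toNNReal (a ^ (Module.finrank ℝ E - 1)) • g (a • (s : E)),
        setIntegral_congr_fun measurableSet_Ioi fun x hx ↦ ?_]
      · rw [NNReal.smul_def, Real.coe_toNNReal _ (pow_nonneg hx.out.le _)]
      · exact (measurable_subtype_coe.pow_const _).real_toNNReal

theorem locallyIntegrable_comp_norm {h : ℝ → F}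
    (hh : ∀ R, IntegrableOn (fun r => r ^ (Module.finrank ℝ E - 1) • h r) (Ioo 0 R)) :
    LocallyIntegrable (fun x : E => h ‖x‖) μ := fun x =>
  ⟨ball 0 (‖x‖ + 1), isOpen_ball.mem_nhds (by simp), (integrableOn_fun_norm_addHaar μ).2 (hh _)⟩

end Polar

/-! ### The kernels and the Newtonian potential -/

/-- The kernel `z |z|⁻ⁿ`, which is `n ω_n` times the gradient of the fundamental solution away from
the origin; its value at the origin is `0`. -/
noncomputable def gradKernel (n : ℕ) (z : EuclideanSpace ℝ (Fin n)) : EuclideanSpace ℝ (Fin n) :=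
  ‖z‖ ^ (-(n : ℤ)) • z

theorem nontrivial_euclideanSpace (hn : 2 ≤ n) : Nontrivial (EuclideanSpace ℝ (Fin n)) :=
  Module.nontrivial_of_finrank_pos (R := ℝ) (by simp; omega)

theorem locallyIntegrable_green (hn : 2 ≤ n) :
    LocallyIntegrable (fun z : EuclideanSpace ℝ (Fin n) => green z 0) := by
  have := nontrivial_euclideanSpace hn
  simp only [green, sub_zero]
  split_ifs with h
  · subst h
    refine locallyIntegrable_comp_norm (h := fun r => 1 / (2 * Real.pi) * Real.log r)
      _ fun R => ?_
    -- `r log r` extends continuously to `r = 0`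
    have hc : Continuous fun r : ℝ => 1 / (2 * Real.pi) * (r * Real.log r) :=
      continuous_const.mul Real.continuous_mul_log
    refine ((hc.integrableOn_Icc (a := 0) (b := R)).mono_set Ioo_subset_Icc_self).congr_fun
      (fun r _ => ?_) measurableSet_Ioo
    simp
    ring
  · refine locallyIntegrable_comp_norm
      (h := fun r => 1 / ((n : ℝ) * (2 - (n : ℝ)) * ballVol n) * r ^ (2 - (n : ℤ)))
      _ fun R => ?_
    have hc : Continuous fun r : ℝ => 1 / ((n : ℝ) * (2 - (n : ℝ)) * ballVol n) * r := by fun_prop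
    refine ((hc.integrableOn_Icc (a := 0) (b := R)).mono_set Ioo_subset_Icc_self).congr_fun
      (fun r hr => ?_) measurableSet_Ioo
    have hr0 : r ≠ 0 := hr.1.ne'
    have : r ^ (n - 1) * r ^ (2 - (n : ℤ)) = r := by
      rw [← zpow_natCast, ← zpow_add₀ hr0]
      conv_rhs => rw [← zpow_one r]
      congr 1
      omega
    simp only [finrank_euclideanSpace, Fintype.card_fin, smul_eq_mul]
    conv_lhs => rw [← this]
    ring

theorem measurable_gradKernel : Measurable (gradKernel n) := by
  unfold gradKernel
  fun_prop

theorem locallyIntegrable_gradKernel (hn : 2 ≤ n) : LocallyIntegrable (gradKernel n) := by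
  have := nontrivial_euclideanSpace hn
  have h : LocallyIntegrable (fun z : EuclideanSpace ℝ (Fin n) => ‖z‖ ^ (1 - (n : ℤ))) := by
    refine locallyIntegrable_comp_norm (h := fun r : ℝ => r ^ (1 - (n : ℤ))) _ fun R => ?_
    refine ((continuous_const (y := (1 : ℝ))).integrableOn_Icc (a := 0) (b := R)
      |>.mono_set Ioo_subset_Icc_self).congr_fun (fun r hr => ?_) measurableSet_Ioo
    have hr0 : r ≠ 0 := hr.1.ne'
    simp only [finrank_euclideanSpace, Fintype.card_fin, smul_eq_mul]
    rw [← zpow_natCast, ← zpow_add₀ hr0, eq_comm, ← zpow_zero r]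
    congr 1
    omega
  refine h.mono measurable_gradKernel.aestronglyMeasurable (Eventually.of_forall fun z => ?_)
  -- at the origin `gradKernel` vanishes and the power of the norm is some nonnegative number
  rcases eq_or_ne z 0 with rfl | hz
  · simpa [gradKernel] using zpow_nonneg le_rfl _
  · have hz' : ‖z‖ ≠ 0 := norm_ne_zero_iff.2 hz
    rw [gradKernel, norm_smul, norm_zpow, norm_zpow, norm_norm, sub_eq_neg_add,
      zpow_add_one₀ hz']

variable {F G : Type*} [NormedAddCommGroup F] [NormedSpace ℝ F]
  [NormedAddCommGroup G] [NormedSpace ℝ G]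

theorem green_eq_green_sub (x y : EuclideanSpace ℝ (Fin n)) : green x y = green (x - y) 0 := by
  simp [green]

/-- The Newtonian potential of a density `f`. -/
noncomputable def potential (f : EuclideanSpace ℝ (Fin n) → F) (x : EuclideanSpace ℝ (Fin n)) :
    F :=
  ∫ y, green x y • f y

theorem potential_eq_convolution (f : EuclideanSpace ℝ (Fin n) → F) :
    potential f = convolution (fun z => green z 0) f (ContinuousLinearMap.lsmul ℝ ℝ) volume := by
  funext x
  rw [convolution_lsmul_swap]
  simp only [potential, ← green_eq_green_sub]

theorem integrable_green_smul (hn : 2 ≤ n) {f : EuclideanSpace ℝ (Fin n) → F}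
    (hf : Continuous f) (hs : HasCompactSupport f) (x : EuclideanSpace ℝ (Fin n)) :
    Integrable fun y => green x y • f y := by
  have := (hs.convolutionExists_right (ContinuousLinearMap.lsmul ℝ ℝ) (locallyIntegrable_green hn)
    hf x).integrable_swap
  simpa only [ContinuousLinearMap.lsmul_apply, ← green_eq_green_sub] using this

theorem integrable_gradKernel (hn : 2 ≤ n) {f : EuclideanSpace ℝ (Fin n) → F}
    (hf : Continuous f) (hs : HasCompactSupport f)
    (B : EuclideanSpace ℝ (Fin n) →L[ℝ] F →L[ℝ] G) (x : EuclideanSpace ℝ (Fin n)) :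
    Integrable fun y => B (gradKernel n (x - y)) (f y) :=
  (hs.convolutionExists_right B (locallyIntegrable_gradKernel hn) hf x).integrable_swap

/-! ### The Laplacian of the potential, in polar coordinates -/

/-- The radial derivative of `f`, integrated against the gradient kernel, gives `f` back: in polar
coordinates centred at `x` the powers of the radius cancel, and each ray contributes `f x` by the
fundamental theorem of calculus. -/
theorem integral_fderiv_gradKernel (hn : 2 ≤ n) [CompleteSpace F]
    {f : EuclideanSpace ℝ (Fin n) → F} (hf : ContDiff ℝ 1 f) (hs : HasCompactSupport f)
    (x : EuclideanSpace ℝ (Fin n)) :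
    ∫ y, fderiv ℝ f y (gradKernel n (x - y)) = ((n : ℝ) * ballVol n) • f x := by
  have := nontrivial_euclideanSpace hn
  have hint : Integrable fun y => fderiv ℝ f y (gradKernel n (x - y)) :=
    integrable_gradKernel hn (hf.continuous_fderiv one_ne_zero) (hs.fderiv ℝ)
      (ContinuousLinearMap.id ℝ (EuclideanSpace ℝ (Fin n) →L[ℝ] F)).flip x
  have hint' := hint.comp_sub_left x
  rw [← integral_sub_left_eq_self _ _ x]
  rw [integral_eq_integral_toSphere_integral_Ioi _ hint']
  have hray : ∀ s : sphere (0 : EuclideanSpace ℝ (Fin n)) 1,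
      ∫ r in Ioi (0 : ℝ), r ^ (Module.finrank ℝ (EuclideanSpace ℝ (Fin n)) - 1) •
        fderiv ℝ f (x - r • (s : EuclideanSpace ℝ (Fin n)))
          (gradKernel n (x - (x - r • (s : EuclideanSpace ℝ (Fin n))))) = f x := by
    intro s
    have hs1 : ‖(s : EuclideanSpace ℝ (Fin n))‖ = 1 := norm_eq_of_mem_sphere s
    let ray : ℝ → EuclideanSpace ℝ (Fin n) := fun r => x - r • (s : EuclideanSpace ℝ (Fin n))
    have hiso : Isometry ray := Isometry.of_dist_eq fun a b => by
      simp only [ray, dist_eq_norm, sub_sub_sub_cancel_left, ← sub_smul, norm_smul, hs1, mul_one,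
        norm_sub_rev]
    have hd : ∀ r, HasDerivAt (fun r => f (ray r))
        (-fderiv ℝ f (ray r) (s : EuclideanSpace ℝ (Fin n))) r := fun r => by
      have h1 : HasDerivAt ray (-(s : EuclideanSpace ℝ (Fin n))) r := by
        simpa using ((hasDerivAt_id r).smul_const (s : EuclideanSpace ℝ (Fin n))).const_sub x
      have := ((hf.differentiable one_ne_zero (ray r)).hasFDerivAt).comp_hasDerivAt r h1
      rwa [map_neg] at this
    have hc : HasCompactSupport fun r => f (ray r) :=
      hs.comp_isClosedEmbedding hiso.isClosedEmbedding
    have hcd : ContDiff ℝ 1 fun r => f (ray r) := hf.comp (by fun_prop)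
    have key := hc.integral_Ioi_deriv_eq hcd 0
    have h0 : f (ray 0) = f x := by simp [ray]
    rw [h0] at key
    rw [← neg_neg (f x), ← key, ← integral_neg]
    refine setIntegral_congr_fun measurableSet_Ioi fun r hr => ?_
    have hr0 : (0 : ℝ) < r := hr
    simp only [(hd r).deriv, neg_neg, sub_sub_cancel, gradKernel, norm_smul, hs1, mul_one,
      Real.norm_eq_abs, abs_of_pos hr0, map_smul, smul_smul, finrank_euclideanSpace,
      Fintype.card_fin]
    have : r ^ (n - 1) * (r ^ (-(n : ℤ)) * r) = 1 := by
      rw [← zpow_natCast, ← zpow_add_one₀ hr0.ne', ← zpow_add₀ hr0.ne', ← zpow_zero r]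
      congr 1
      omega
    rw [this, one_smul]
  simp only [hray]
  simp only [integral_const, Measure.toSphere_real_apply_univ, finrank_euclideanSpace,
    Fintype.card_fin]
  rfl

/-! ### Integration by parts against the fundamental solution -/

/-- The fundamental solution as a function of the squared distance, in which it is monotone and
which, unlike the distance itself, is smooth in both points. -/
noncomputable def greenSq (n : ℕ) (s : ℝ) : ℝ :=
  if n = 2 then 1 / (4 * Real.pi) * Real.log s
  else 1 / ((n : ℝ) * (2 - (n : ℝ)) * ballVol n) * s ^ ((2 - (n : ℝ)) / 2)

/-- This holds for `x = y` as well, where the conventions for `log 0` and for powers of `0` agree on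
both sides. -/
theorem green_eq_greenSq (x y : EuclideanSpace ℝ (Fin n)) :
    green x y = greenSq n (‖x - y‖ ^ 2) := by
  unfold green greenSq
  split_ifs with h
  · rw [Real.log_pow]
    push_cast
    field_simp
    ring
  · congr 1
    rw [← Real.rpow_intCast, ← Real.rpow_natCast, ← Real.rpow_mul (norm_nonneg _)]
    congr 1
    push_cast
    ring

theorem ballVol_pos (hn : 2 ≤ n) : 0 < ballVol n := by
  have := nontrivial_euclideanSpace hn
  exact ENNReal.toReal_pos (measure_ball_pos _ _ one_pos).ne' measure_ball_lt_top.ne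

theorem ballVol_two : ballVol 2 = Real.pi := by
  simp [ballVol, EuclideanSpace.volume_ball_fin_two, Real.pi_pos.le]

theorem hasDerivAt_greenSq (hn : 2 ≤ n) {s : ℝ} (hs : 0 < s) :
    HasDerivAt (greenSq n) (1 / (2 * (n * ballVol n)) * s ^ (-(n : ℝ) / 2)) s := by
  have hω := ballVol_pos hn
  unfold greenSq
  split_ifs with h
  · subst h
    refine ((Real.hasDerivAt_log hs.ne').const_mul (1 / (4 * Real.pi))).congr_deriv ?_
    rw [ballVol_two, show (-((2 : ℕ) : ℝ) / 2) = -1 by norm_num, Real.rpow_neg_one]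
    push_cast
    ring
  · refine ((Real.hasDerivAt_rpow_const (p := (2 - (n : ℝ)) / 2) (Or.inl hs.ne')).const_mul
      (1 / ((n : ℝ) * (2 - (n : ℝ)) * ballVol n))).congr_deriv ?_
    have hn2 : (2 : ℝ) - n ≠ 0 := sub_ne_zero.2 fun hh => h (by exact_mod_cast hh.symm)
    have hn0 : (n : ℝ) ≠ 0 := by positivity
    rw [show (2 - (n : ℝ)) / 2 - 1 = -(n : ℝ) / 2 by ring]
    field_simp

theorem monotoneOn_greenSq (hn : 2 ≤ n) : MonotoneOn (greenSq n) (Ioi 0) := by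
  have hω := ballVol_pos hn
  refine monotoneOn_of_deriv_nonneg (convex_Ioi 0)
    (fun s hs => (hasDerivAt_greenSq hn hs).continuousAt.continuousWithinAt) ?_ ?_
  · rw [interior_Ioi]
    exact fun s hs => (hasDerivAt_greenSq hn hs).differentiableAt.differentiableWithinAt
  · rw [interior_Ioi]
    intro s (hs : 0 < s)
    rw [(hasDerivAt_greenSq hn hs).deriv]
    positivity

theorem norm_sq_rpow (z : EuclideanSpace ℝ (Fin n)) :
    (‖z‖ ^ 2) ^ (-(n : ℝ) / 2) = ‖z‖ ^ (-(n : ℤ)) := by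
  rw [← Real.rpow_intCast, ← Real.rpow_natCast, ← Real.rpow_mul (norm_nonneg _)]
  congr 1
  push_cast
  ring

theorem continuous_greenSq_norm_sq_add (hn : 2 ≤ n) (x : EuclideanSpace ℝ (Fin n)) {δ : ℝ}
    (hδ : 0 < δ) :
    Continuous fun y => greenSq n (‖x - y‖ ^ 2 + δ) :=
  continuous_iff_continuousAt.2 fun y =>
    ContinuousAt.comp (f := fun y => ‖x - y‖ ^ 2 + δ)
      (hasDerivAt_greenSq hn (by positivity)).continuousAt (by fun_prop)

theorem continuous_inner_mul_rpow (x v : EuclideanSpace ℝ (Fin n)) {δ : ℝ} (hδ : 0 < δ) :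
    Continuous fun y => inner ℝ (x - y) v * (‖x - y‖ ^ 2 + δ) ^ (-(n : ℝ) / 2) :=
  Continuous.mul (by fun_prop) <| Continuous.rpow_const (by fun_prop) fun y =>
    Or.inl (by positivity)

/-- Integration by parts against the smooth kernel obtained by adding `δ` to the squared
distance. -/
theorem integral_greenSq_smul_fderiv (hn : 2 ≤ n) {f : EuclideanSpace ℝ (Fin n) → F}
    (hf : ContDiff ℝ 1 f) (hs : HasCompactSupport f) (x v : EuclideanSpace ℝ (Fin n)) {δ : ℝ}
    (hδ : 0 < δ) :
    ∫ y, greenSq n (‖x - y‖ ^ 2 + δ) • fderiv ℝ f y v = (1 / (n * ballVol n)) •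
      ∫ y, (inner ℝ (x - y) v * (‖x - y‖ ^ 2 + δ) ^ (-(n : ℝ) / 2)) • f y := by
  have hcf := hf.continuous_fderiv one_ne_zero
  have hcg := continuous_greenSq_norm_sq_add hn x hδ
  have hcd := continuous_inner_mul_rpow x v hδ
  let g' : EuclideanSpace ℝ (Fin n) → EuclideanSpace ℝ (Fin n) →L[ℝ] ℝ := fun y =>
    (1 / (2 * (n * ballVol n)) * (‖x - y‖ ^ 2 + δ) ^ (-(n : ℝ) / 2)) •
      ((2 : ℕ) • (innerSL ℝ (x - y)).comp
        (-ContinuousLinearMap.id ℝ (EuclideanSpace ℝ (Fin n))))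
  have hg : ∀ y, HasFDerivAt (fun y => greenSq n (‖x - y‖ ^ 2 + δ)) (g' y) y := fun y => by
    have h1 : HasFDerivAt (fun y => x - y)
        (-ContinuousLinearMap.id ℝ (EuclideanSpace ℝ (Fin n))) y :=
      (hasFDerivAt_id y).const_sub x
    have h2 := (h1.norm_sq).add_const δ
    exact (hasDerivAt_greenSq hn (s := ‖x - y‖ ^ 2 + δ) (by positivity)).comp_hasFDerivAt y h2
  have hg' : ∀ y, g' y v = -(1 / (n * ballVol n) *
      (inner ℝ (x - y) v * (‖x - y‖ ^ 2 + δ) ^ (-(n : ℝ) / 2))) := fun y => by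
    have hω := (ballVol_pos hn).ne'
    have hn0 : (n : ℝ) ≠ 0 := by positivity
    simp [g', inner_sub_left]
    field_simp
    ring
  have key := integral_bilinear_hasFDerivAt_right_eq_neg_left_of_integrable (μ := volume)
    (B := ContinuousLinearMap.lsmul ℝ ℝ) (f := fun y => greenSq n (‖x - y‖ ^ 2 + δ)) (f' := g')
    (g := f) (g' := fderiv ℝ f) (v := v) ?_ ?_ ?_ (fun y _ => hg y)
    (fun y _ => (hf.differentiable one_ne_zero y).hasFDerivAt)
  · simp only [ContinuousLinearMap.lsmul_apply] at key
    rw [key, ← integral_neg, ← integral_smul]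
    refine integral_congr_ae (Eventually.of_forall fun y => ?_)
    simp only [hg', neg_smul, neg_neg, smul_smul]
  · simp only [hg', ContinuousLinearMap.lsmul_apply]
    exact Continuous.integrable_of_hasCompactSupport
      (((continuous_const.mul hcd).neg).smul hf.continuous) hs.smul_left
  · exact Continuous.integrable_of_hasCompactSupport
      (hcg.smul (hcf.clm_apply continuous_const)) (hs.fderiv_apply ℝ v).smul_left
  · exact Continuous.integrable_of_hasCompactSupport (hcg.smul hf.continuous) hs.smul_left

/-- A derivative is moved from the density to the fundamental solution. The smooth kernels
`greenSq n (|x - y|² + δ)` increase in `δ`, so that those with `0 < δ ≤ 1` lie between the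
singular kernel and the one for `δ = 1`, and dominated convergence applies as `δ → 0`. -/
theorem integral_green_smul_fderiv (hn : 2 ≤ n) {f : EuclideanSpace ℝ (Fin n) → F}
    (hf : ContDiff ℝ 1 f) (hs : HasCompactSupport f) (x v : EuclideanSpace ℝ (Fin n)) :
    ∫ y, green x y • fderiv ℝ f y v =
      (1 / (n * ballVol n)) • ∫ y, inner ℝ (gradKernel n (x - y)) v • f y := by
  have := nontrivial_euclideanSpace hn
  have hcf : Continuous fun y => fderiv ℝ f y v :=
    (hf.continuous_fderiv one_ne_zero).clm_apply continuous_const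
  have hsf := hs.fderiv_apply ℝ v
  have hne : ∀ᵐ y : EuclideanSpace ℝ (Fin n), 0 < ‖x - y‖ ^ 2 := by
    filter_upwards [Measure.ae_ne volume x] with y hy
    have := norm_pos_iff.2 (sub_ne_zero.2 hy.symm)
    positivity
  have hδ : ∀ᶠ δ : ℝ in 𝓝[>] 0, δ ∈ Ioc (0 : ℝ) 1 := Ioc_mem_nhdsGT one_pos
  have hadd : ∀ s : ℝ, Tendsto (fun δ => s + δ) (𝓝[>] 0) (𝓝 s) := fun s => by
    have : Tendsto (fun δ : ℝ => s + δ) (𝓝 0) (𝓝 (s + 0)) := (continuous_const_add s).tendsto 0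
    rw [add_zero] at this
    exact this.mono_left nhdsWithin_le_nhds
  have hleft : Tendsto (fun δ => ∫ y, greenSq n (‖x - y‖ ^ 2 + δ) • fderiv ℝ f y v) (𝓝[>] 0)
      (𝓝 (∫ y, green x y • fderiv ℝ f y v)) := by
    refine tendsto_integral_filter_of_dominated_convergence
      (fun y => ‖green x y • fderiv ℝ f y v‖ + ‖greenSq n (‖x - y‖ ^ 2 + 1) • fderiv ℝ f y v‖)
      ?_ ?_ ?_ ?_
    · filter_upwards [hδ] with δ hδ
      exact ((continuous_greenSq_norm_sq_add hn x hδ.1).smul hcf).aestronglyMeasurable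
    · filter_upwards [hδ] with δ hδ
      filter_upwards [hne] with y hy
      simp only [norm_smul, ← add_mul, Real.norm_eq_abs, green_eq_greenSq]
      refine mul_le_mul_of_nonneg_right ?_ (norm_nonneg _)
      have h1 := monotoneOn_greenSq hn (mem_Ioi.2 hy) (mem_Ioi.2 (add_pos hy hδ.1))
        (le_add_of_nonneg_right hδ.1.le)
      have h2 := monotoneOn_greenSq hn (mem_Ioi.2 (add_pos hy hδ.1))
        (mem_Ioi.2 (add_pos hy one_pos)) (add_le_add_right hδ.2 _)
      exact (abs_le_max_abs_abs h1 h2).trans (max_le_add_of_nonneg (abs_nonneg _) (abs_nonneg _))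
    · exact (integrable_green_smul hn hcf hsf x).norm.add
        (Continuous.integrable_of_hasCompactSupport
          ((continuous_greenSq_norm_sq_add hn x one_pos).smul hcf) hsf.smul_left).norm
    · filter_upwards [hne] with y hy
      rw [green_eq_greenSq]
      exact ((hasDerivAt_greenSq hn hy).continuousAt.tendsto.comp (hadd _)).smul_const _
  have hright : Tendsto (fun δ => ∫ y,
        (inner ℝ (x - y) v * (‖x - y‖ ^ 2 + δ) ^ (-(n : ℝ) / 2)) • f y) (𝓝[>] 0)
      (𝓝 (∫ y, inner ℝ (gradKernel n (x - y)) v • f y)) := by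
    have hker : ∀ y, inner ℝ (gradKernel n (x - y)) v =
        inner ℝ (x - y) v * (‖x - y‖ ^ 2) ^ (-(n : ℝ) / 2) := fun y => by
      rw [gradKernel, inner_smul_left, norm_sq_rpow, conj_trivial, mul_comm]
    refine tendsto_integral_filter_of_dominated_convergence
      (fun y => ‖inner ℝ (gradKernel n (x - y)) v • f y‖) ?_ ?_ ?_ ?_
    · filter_upwards [hδ] with δ hδ
      exact ((continuous_inner_mul_rpow x v hδ.1).smul hf.continuous).aestronglyMeasurable
    · filter_upwards [hδ] with δ hδ
      filter_upwards [hne] with y hy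
      simp only [hker, norm_smul, norm_mul]
      refine mul_le_mul_of_nonneg_right (mul_le_mul_of_nonneg_left ?_ (norm_nonneg _))
        (norm_nonneg _)
      have hδ0 := hδ.1.le
      rw [Real.norm_of_nonneg (by positivity), Real.norm_of_nonneg (by positivity)]
      refine Real.rpow_le_rpow_of_nonpos hy (le_add_of_nonneg_right hδ.1.le) ?_
      have : (0 : ℝ) ≤ n := n.cast_nonneg
      linarith
    · exact (integrable_gradKernel hn hf.continuous hs
        ((ContinuousLinearMap.lsmul ℝ ℝ).comp ((innerSL ℝ).flip v)) x).norm
    · filter_upwards [hne] with y hy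
      rw [hker]
      refine Tendsto.smul_const (Tendsto.const_mul _ ?_) _
      exact (Real.continuousAt_rpow_const _ _ (Or.inl hy.ne')).tendsto.comp (hadd _)
  refine tendsto_nhds_unique hleft ((hright.const_smul (1 / (n * ballVol n))).congr' ?_)
  filter_upwards [hδ] with δ hδ
  exact (integral_greenSq_smul_fderiv hn hf hs x v hδ.1).symm

/-! ### First-order differential operators with constant coefficients -/

/-- The operator `∑ᵢ B(eᵢ) ∂ᵢ` with symbol `B`. The gradient, the divergence, `M_∇` and `M_∇ᵀ` are
all of this form. -/
noncomputable def diffOp (B : EuclideanSpace ℝ (Fin n) →L[ℝ] F →L[ℝ] G)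
    (f : EuclideanSpace ℝ (Fin n) → F) (x : EuclideanSpace ℝ (Fin n)) : G :=
  ∑ i, B (EuclideanSpace.single i 1) (partialD i f x)

/-- The symbol of the gradient. -/
noncomputable def gradSymbol (n : ℕ) :
    EuclideanSpace ℝ (Fin n) →L[ℝ] ℝ →L[ℝ] EuclideanSpace ℝ (Fin n) :=
  (ContinuousLinearMap.lsmul ℝ ℝ).flip

@[simp]
theorem gradSymbol_apply (v : EuclideanSpace ℝ (Fin n)) (r : ℝ) : gradSymbol n v r = r • v := rfl

/-- The symbol of the divergence. -/
noncomputable def divSymbol (n : ℕ) :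
    EuclideanSpace ℝ (Fin n) →L[ℝ] EuclideanSpace ℝ (Fin n) →L[ℝ] ℝ :=
  innerSL ℝ

@[simp]
theorem divSymbol_apply (v w : EuclideanSpace ℝ (Fin n)) : divSymbol n v w = inner ℝ v w := rfl

theorem vdiv_eq_diffOp (a : EuclideanSpace ℝ (Fin n) → EuclideanSpace ℝ (Fin n)) :
    vdiv a = diffOp (divSymbol n) a := by
  funext x
  simp [vdiv, diffOp, EuclideanSpace.inner_single_left]

theorem ncurl_eq_diffOp (a : EuclideanSpace ℝ (Fin n) → EuclideanSpace ℝ (Fin n)) :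
    ncurl a = diffOp (crossMulL n) a := rfl

theorem ncurlT_eq_diffOp (w : EuclideanSpace ℝ (Fin n) → EuclideanSpace ℝ (Fin (crossDim n))) :
    ncurlT w = diffOp (crossMulTL n) w := rfl

theorem gradient_eq_diffOp (φ : EuclideanSpace ℝ (Fin n) → ℝ) :
    gradient φ = diffOp (gradSymbol n) φ := by
  funext x
  ext i
  have h : inner ℝ (gradient φ x) (EuclideanSpace.single i (1 : ℝ)) =
      fderiv ℝ φ x (EuclideanSpace.single i 1) := by
    rw [gradient, InnerProductSpace.toDual_symm_apply]
  rw [EuclideanSpace.inner_single_right] at h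
  simpa [diffOp, partialD, Pi.single_apply] using h

/-- Since `diffOp B f` is a fixed linear image of `fderiv ℝ f`, it inherits smoothness, compact
support, and compatibility with potentials from the total derivative. -/
theorem diffOp_eq_comp_fderiv (B : EuclideanSpace ℝ (Fin n) →L[ℝ] F →L[ℝ] G) :
    ∃ L : (EuclideanSpace ℝ (Fin n) →L[ℝ] F) →L[ℝ] G,
      ∀ f : EuclideanSpace ℝ (Fin n) → F, diffOp B f = fun x => L (fderiv ℝ f x) :=
  ⟨∑ i, (B (EuclideanSpace.single i 1)).comp
    (ContinuousLinearMap.apply ℝ F (EuclideanSpace.single i 1)), fun f => by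
      funext x
      simp [diffOp, partialD, sum_apply]⟩

theorem contDiff_diffOp (B : EuclideanSpace ℝ (Fin n) →L[ℝ] F →L[ℝ] G)
    {f : EuclideanSpace ℝ (Fin n) → F} (hf : ContDiff ℝ ∞ f) : ContDiff ℝ ∞ (diffOp B f) := by
  obtain ⟨L, hL⟩ := diffOp_eq_comp_fderiv B
  rw [hL]
  exact L.contDiff.comp (hf.fderiv_right (by simp))

theorem hasCompactSupport_diffOp (B : EuclideanSpace ℝ (Fin n) →L[ℝ] F →L[ℝ] G)
    {f : EuclideanSpace ℝ (Fin n) → F} (hs : HasCompactSupport f) :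
    HasCompactSupport (diffOp B f) := by
  obtain ⟨L, hL⟩ := diffOp_eq_comp_fderiv B
  rw [hL]
  exact (hs.fderiv ℝ).comp_left (map_zero L)

theorem partialD_partialD {f : EuclideanSpace ℝ (Fin n) → F} (hf : ContDiff ℝ ∞ f) (i j : Fin n)
    (x : EuclideanSpace ℝ (Fin n)) :
    partialD i (partialD j f) x =
      fderiv ℝ (fderiv ℝ f) x (EuclideanSpace.single i 1) (EuclideanSpace.single j 1) := by
  have hd : DifferentiableAt ℝ (fderiv ℝ f) x :=
    (hf.fderiv_right (m := ∞) (by simp)).differentiable (by simp) x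
  have h := (hd.hasFDerivAt.clm_apply
    (hasFDerivAt_const (EuclideanSpace.single j (1 : ℝ)) x)).fderiv
  unfold partialD
  rw [h]
  simp

theorem partialD_comm {f : EuclideanSpace ℝ (Fin n) → F} (hf : ContDiff ℝ ∞ f) (i j : Fin n)
    (x : EuclideanSpace ℝ (Fin n)) :
    partialD i (partialD j f) x = partialD j (partialD i f) x := by
  rw [partialD_partialD hf, partialD_partialD hf]
  refine (hf.contDiffAt.isSymmSndFDerivAt ?_).eq _ _
  rw [minSmoothness_of_isRCLikeNormedField]
  exact WithTop.coe_le_coe.2 (le_top : (2 : ℕ∞) ≤ ⊤)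

theorem contDiff_partialD {f : EuclideanSpace ℝ (Fin n) → F} (hf : ContDiff ℝ ∞ f) (i : Fin n) :
    ContDiff ℝ ∞ (partialD i f) :=
  (hf.fderiv_right (m := ∞) (by simp)).clm_apply contDiff_const

theorem diffOp_diffOp {H : Type*} [NormedAddCommGroup H] [NormedSpace ℝ H]
    (B : EuclideanSpace ℝ (Fin n) →L[ℝ] G →L[ℝ] H) (C : EuclideanSpace ℝ (Fin n) →L[ℝ] F →L[ℝ] G)
    {f : EuclideanSpace ℝ (Fin n) → F} (hf : ContDiff ℝ ∞ f) (x : EuclideanSpace ℝ (Fin n)) :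
    diffOp B (diffOp C f) x = ∑ i, ∑ j, B (EuclideanSpace.single i 1)
      (C (EuclideanSpace.single j 1) (partialD i (partialD j f) x)) := by
  have h : ∀ i, partialD i (diffOp C f) x =
      ∑ j, C (EuclideanSpace.single j 1) (partialD i (partialD j f) x) := fun i => by
    have hd : HasFDerivAt (diffOp C f) (∑ j, (C (EuclideanSpace.single j 1)).comp
        (fderiv ℝ (partialD j f) x)) x :=
      HasFDerivAt.fun_sum fun j _ => (C (EuclideanSpace.single j 1)).hasFDerivAt.comp x
        ((contDiff_partialD hf j).differentiable (by simp) x).hasFDerivAt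
    rw [partialD, hd.fderiv, sum_apply]
    rfl
  rw [diffOp]
  simp only [h, map_sum]

/-- Only the symmetric part of a coefficient matrix acts on a symmetric matrix of second
derivatives; here that part is a multiple of the identity matrix. -/
theorem sum_sum_eq_of_symm {X : Type*} {q : Fin n → Fin n → X → G} {D : X → G}
    {H : Fin n → Fin n → X}
    (hH : ∀ i j, H i j = H j i)
    (hq : ∀ i j w, q i j w + q j i w = if i = j then (2 : ℝ) • D w else 0) :
    ∑ i, ∑ j, q i j (H i j) = ∑ i, D (H i i) := by
  have h : ∑ i, ∑ j, q i j (H i j) + ∑ i, ∑ j, q i j (H i j) = (2 : ℝ) • ∑ i, D (H i i) := by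
    nth_rewrite 2 [Finset.sum_comm]
    simp only [← Finset.sum_add_distrib]
    rw [Finset.smul_sum]
    refine Finset.sum_congr rfl fun i _ => ?_
    simp only [hH _ i, hq]
    simp
  rw [← two_smul ℝ] at h
  exact smul_right_injective G two_ne_zero h

/-- The curl of a gradient vanishes. -/
theorem ncurl_gradient {φ : EuclideanSpace ℝ (Fin n) → ℝ} (hφ : ContDiff ℝ ∞ φ)
    (x : EuclideanSpace ℝ (Fin n)) : ncurl (gradient φ) x = 0 := by
  rw [gradient_eq_diffOp, ncurl_eq_diffOp, diffOp_diffOp _ _ hφ]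
  refine (sum_sum_eq_of_symm (D := fun _ => 0) (q := fun i j r =>
    crossMulL n (EuclideanSpace.single i 1) (gradSymbol n (EuclideanSpace.single j 1) r))
    (partialD_comm hφ · · x) fun i j r => ?_).trans Finset.sum_const_zero
  simp only [gradSymbol_apply, map_smul, crossMulL_apply, smul_zero, ite_self]
  rw [crossMul_antisymm, smul_neg, neg_add_cancel]

/-- The divergence of `M_∇ᵀ w` vanishes. -/
theorem vdiv_ncurlT {w : EuclideanSpace ℝ (Fin n) → EuclideanSpace ℝ (Fin (crossDim n))}
    (hw : ContDiff ℝ ∞ w) (x : EuclideanSpace ℝ (Fin n)) : vdiv (ncurlT w) x = 0 := by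
  rw [vdiv_eq_diffOp, ncurlT_eq_diffOp, diffOp_diffOp _ _ hw]
  refine (sum_sum_eq_of_symm (D := fun _ => 0) (q := fun i j w =>
    divSymbol n (EuclideanSpace.single i 1) (crossMulTL n (EuclideanSpace.single j 1) w))
    (partialD_comm hw · · x) fun i j w => ?_).trans Finset.sum_const_zero
  simp only [divSymbol_apply, crossMulTL_apply, smul_zero, ite_self]
  rw [real_inner_comm, inner_crossMulT, real_inner_comm _ (EuclideanSpace.single j (1 : ℝ)),
    inner_crossMulT, crossMul_antisymm, inner_neg_right, neg_add_cancel]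

/-- The identity `∇ div + M_∇ᵀ M_∇ = Δ`. -/
theorem gradient_vdiv_add_ncurlT_ncurl {u : EuclideanSpace ℝ (Fin n) → EuclideanSpace ℝ (Fin n)}
    (hu : ContDiff ℝ ∞ u) (x : EuclideanSpace ℝ (Fin n)) :
    gradient (vdiv u) x + ncurlT (ncurl u) x = ∑ i, partialD i (partialD i u) x := by
  rw [gradient_eq_diffOp, vdiv_eq_diffOp, ncurlT_eq_diffOp, ncurl_eq_diffOp,
    diffOp_diffOp _ _ hu, diffOp_diffOp _ _ hu]
  simp only [← Finset.sum_add_distrib]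
  refine sum_sum_eq_of_symm (D := id)
    (q := fun i j w => gradSymbol n (EuclideanSpace.single i 1)
        (divSymbol n (EuclideanSpace.single j 1) w) +
      crossMulTL n (EuclideanSpace.single i 1) (crossMulL n (EuclideanSpace.single j 1) w))
    (partialD_comm hu · · x) fun i j w => ?_
  simp only [gradSymbol_apply, divSymbol_apply, crossMulTL_apply, crossMulL_apply,
    crossMulT_crossMul, real_inner_comm w]
  split_ifs with h
  · subst h
    have h1 : inner ℝ (EuclideanSpace.single i (1 : ℝ)) (EuclideanSpace.single i (1 : ℝ)) =
        (1 : ℝ) := by simp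
    rw [h1, one_smul, two_smul, id]
    abel
  · have h1 : inner ℝ (EuclideanSpace.single i (1 : ℝ)) (EuclideanSpace.single j (1 : ℝ)) =
        (0 : ℝ) := by simp [EuclideanSpace.inner_single_left, h]
    rw [real_inner_comm (EuclideanSpace.single i (1 : ℝ)) (EuclideanSpace.single j 1), h1,
      zero_smul]
    abel

/-! ### Calculus of the Newtonian potential -/

theorem contDiff_potential (hn : 2 ≤ n) {f : EuclideanSpace ℝ (Fin n) → F} (hf : ContDiff ℝ ∞ f)
    (hs : HasCompactSupport f) : ContDiff ℝ ∞ (potential f) := by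
  rw [potential_eq_convolution]
  exact hs.contDiff_convolution_right (n := ⊤) _ (locallyIntegrable_green hn) hf

theorem fderiv_potential_apply (hn : 2 ≤ n) {f : EuclideanSpace ℝ (Fin n) → F}
    (hf : ContDiff ℝ 1 f) (hs : HasCompactSupport f) (x v : EuclideanSpace ℝ (Fin n)) :
    fderiv ℝ (potential f) x v = potential (fun y => fderiv ℝ f y v) x := by
  rw [potential_eq_convolution, potential_eq_convolution,
    (hs.hasFDerivAt_convolution_right _ (locallyIntegrable_green hn) hf x).fderiv,
    convolution_precompR_apply _ (locallyIntegrable_green hn) (hs.fderiv ℝ)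
      (hf.continuous_fderiv one_ne_zero)]

theorem map_potential [CompleteSpace F] [CompleteSpace G] (hn : 2 ≤ n) (L : F →L[ℝ] G)
    {f : EuclideanSpace ℝ (Fin n) → F} (hf : Continuous f) (hs : HasCompactSupport f)
    (x : EuclideanSpace ℝ (Fin n)) :
    L (potential f x) = potential (fun y => L (f y)) x := by
  simp only [potential]
  rw [← L.integral_comp_comm (integrable_green_smul hn hf hs x)]
  simp only [map_smul]

theorem fderiv_potential [CompleteSpace F] (hn : 2 ≤ n) {f : EuclideanSpace ℝ (Fin n) → F}
    (hf : ContDiff ℝ 1 f) (hs : HasCompactSupport f) :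
    fderiv ℝ (potential f) = potential (fderiv ℝ f) := by
  funext x
  ext v
  rw [fderiv_potential_apply hn hf hs]
  exact (map_potential hn (ContinuousLinearMap.apply ℝ F v) (hf.continuous_fderiv one_ne_zero)
    (hs.fderiv ℝ) x).symm

theorem diffOp_potential [CompleteSpace F] [CompleteSpace G] (hn : 2 ≤ n)
    (B : EuclideanSpace ℝ (Fin n) →L[ℝ] F →L[ℝ] G) {f : EuclideanSpace ℝ (Fin n) → F}
    (hf : ContDiff ℝ 1 f) (hs : HasCompactSupport f) :
    diffOp B (potential f) = potential (diffOp B f) := by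
  obtain ⟨L, hL⟩ := diffOp_eq_comp_fderiv B
  funext x
  rw [hL, hL, fderiv_potential hn hf hs]
  exact map_potential hn L (hf.continuous_fderiv one_ne_zero) (hs.fderiv ℝ) x

/-- Differentiation of a potential under the integral sign, where the derivatives fall on the
fundamental solution and the density is not differentiated. -/
theorem diffOp_potential_eq_integral [CompleteSpace F] [CompleteSpace G] (hn : 2 ≤ n)
    (B : EuclideanSpace ℝ (Fin n) →L[ℝ] F →L[ℝ] G) {f : EuclideanSpace ℝ (Fin n) → F}
    (hf : ContDiff ℝ 1 f) (hs : HasCompactSupport f) (x : EuclideanSpace ℝ (Fin n)) :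
    diffOp B (potential f) x =
      (1 / (n * ballVol n)) • ∫ y, B (gradKernel n (x - y)) (f y) := by
  have hK : ∀ i : Fin n, Integrable fun y =>
      inner ℝ (gradKernel n (x - y)) (EuclideanSpace.single i (1 : ℝ)) • f y := fun i =>
    integrable_gradKernel hn hf.continuous hs ((ContinuousLinearMap.lsmul ℝ ℝ).comp
      ((innerSL ℝ).flip (EuclideanSpace.single i (1 : ℝ)))) x
  have hp : ∀ i, partialD i (potential f) x = (1 / (n * ballVol n)) •
      ∫ y, inner ℝ (gradKernel n (x - y)) (EuclideanSpace.single i (1 : ℝ)) • f y := fun i => by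
    rw [partialD, fderiv_potential_apply hn hf hs]
    exact integral_green_smul_fderiv hn hf hs x _
  have hB : ∀ i, Integrable fun y => B (EuclideanSpace.single i 1)
      (inner ℝ (gradKernel n (x - y)) (EuclideanSpace.single i (1 : ℝ)) • f y) := fun i =>
    (B (EuclideanSpace.single i 1)).integrable_comp (hK i)
  simp only [diffOp, hp, map_smul]
  rw [← Finset.smul_sum]
  congr 1
  simp only [← ContinuousLinearMap.integral_comp_comm _ (hK _)]
  rw [← integral_finsetSum _ fun i _ => hB i]
  refine integral_congr_ae (Eventually.of_forall fun y => ?_)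
  -- expand the kernel in the standard basis
  have hsum : gradKernel n (x - y) = ∑ i, inner ℝ (gradKernel n (x - y))
      (EuclideanSpace.single i (1 : ℝ)) • EuclideanSpace.single i (1 : ℝ) := by
    ext k
    simp [EuclideanSpace.inner_single_right, Pi.single_apply]
  beta_reduce
  conv_rhs => rw [hsum]
  simp only [map_sum, map_smul, sum_apply, smul_apply]

/-- The potential solves Poisson's equation `Δ (potential f) = f`. -/
theorem laplacian_potential [CompleteSpace F] (hn : 2 ≤ n) {f : EuclideanSpace ℝ (Fin n) → F}
    (hf : ContDiff ℝ ∞ f) (hs : HasCompactSupport f) (x : EuclideanSpace ℝ (Fin n)) :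
    ∑ i, partialD i (partialD i (potential f)) x = f x := by
  have hf1 : ContDiff ℝ 1 f := hf.of_le (by simp)
  have hc : (n : ℝ) * ballVol n ≠ 0 := mul_ne_zero (by positivity) (ballVol_pos hn).ne'
  have h := diffOp_potential_eq_integral hn
    (ContinuousLinearMap.id ℝ (EuclideanSpace ℝ (Fin n) →L[ℝ] F)).flip
    (hf.fderiv_right (m := 1) (by norm_cast)) (hs.fderiv ℝ) x
  rw [← fderiv_potential hn hf1 hs] at h
  simp only [ContinuousLinearMap.flip_apply, ContinuousLinearMap.id_apply] at h
  rw [integral_fderiv_gradKernel hn hf1 hs, smul_smul, one_div_mul_cancel hc, one_smul] at h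
  rw [← h]
  simp only [partialD_partialD (contDiff_potential hn hf hs)]
  rfl

end Helmholtz

/-! ### The Helmholtz decomposition -/

open Helmholtz in
theorem mainTheorem5 (n : ℕ) (hn : 2 ≤ n)
    (a : EuclideanSpace ℝ (Fin n) → EuclideanSpace ℝ (Fin n))
    (ha : ContDiff ℝ ∞ a) (hsupp : HasCompactSupport a) :
    ∃ aCurl aDiv : EuclideanSpace ℝ (Fin n) → EuclideanSpace ℝ (Fin n),
      -- the decomposition into a curl-free and a divergence-free smooth field
      ContDiff ℝ ∞ aCurl ∧ ContDiff ℝ ∞ aDiv ∧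
      (∀ x, a x = aCurl x + aDiv x) ∧
      (∀ x, Helmholtz.ncurl aCurl x = 0) ∧
      (∀ x, Helmholtz.vdiv aDiv x = 0) ∧
      -- all the integrals below converge absolutely, and the potentials are smooth
      (∀ x, MeasureTheory.Integrable (fun y => Helmholtz.green x y * Helmholtz.vdiv a y)) ∧
      (∀ x, MeasureTheory.Integrable (fun y => Helmholtz.green x y • Helmholtz.ncurl a y)) ∧
      (∀ x, MeasureTheory.Integrable
        (fun y => (‖x - y‖ ^ (-(n : ℤ)) * Helmholtz.vdiv a y) • (x - y))) ∧
      (∀ x, MeasureTheory.Integrable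
        (fun y => Helmholtz.crossMulT (x - y)
          (‖x - y‖ ^ (-(n : ℤ)) • Helmholtz.ncurl a y))) ∧
      ContDiff ℝ ∞ (fun x => ∫ y, Helmholtz.green x y * Helmholtz.vdiv a y) ∧
      ContDiff ℝ ∞ (fun x => ∫ y, Helmholtz.green x y • Helmholtz.ncurl a y) ∧
      -- the two formulas for the curl-free part
      (∀ x, aCurl x =
        gradient (fun z => ∫ y, Helmholtz.green z y * Helmholtz.vdiv a y) x) ∧
      (∀ x, aCurl x = (1 / ((n : ℝ) * Helmholtz.ballVol n)) •
        ∫ y, (‖x - y‖ ^ (-(n : ℤ)) * Helmholtz.vdiv a y) • (x - y)) ∧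
      -- the two formulas for the divergence-free part
      (∀ x, aDiv x =
        Helmholtz.ncurlT (fun z => ∫ y, Helmholtz.green z y • Helmholtz.ncurl a y) x) ∧
      (∀ x, aDiv x = (1 / ((n : ℝ) * Helmholtz.ballVol n)) •
        ∫ y, Helmholtz.crossMulT (x - y)
          (‖x - y‖ ^ (-(n : ℤ)) • Helmholtz.ncurl a y)) := by
  have hdiv : ContDiff ℝ ∞ (vdiv a) := by
    rw [vdiv_eq_diffOp]
    exact contDiff_diffOp _ ha
  have hcurl : ContDiff ℝ ∞ (ncurl a) := contDiff_diffOp (crossMulL n) ha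
  have hdivs : HasCompactSupport (vdiv a) := by
    rw [vdiv_eq_diffOp]
    exact hasCompactSupport_diffOp _ hsupp
  have hcurls : HasCompactSupport (ncurl a) := hasCompactSupport_diffOp (crossMulL n) hsupp
  have h1 : (1 : WithTop ℕ∞) ≤ ∞ := by simp
  have hφ : ContDiff ℝ ∞ (potential (vdiv a)) := contDiff_potential hn hdiv hdivs
  have hw : ContDiff ℝ ∞ (potential (ncurl a)) := contDiff_potential hn hcurl hcurls
  -- the potentials of `div a` and of `curl a` are the divergence and the curl of that of `a`
  have hpdiv : potential (vdiv a) = vdiv (potential a) := by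
    rw [vdiv_eq_diffOp, vdiv_eq_diffOp, diffOp_potential hn _ (ha.of_le h1) hsupp]
  have hpcurl : potential (ncurl a) = ncurl (potential a) :=
    (diffOp_potential hn (crossMulL n) (ha.of_le h1) hsupp).symm
  refine ⟨gradient (potential (vdiv a)), ncurlT (potential (ncurl a)), ?_, ?_, ?_, ?_, ?_, ?_, ?_,
    ?_, ?_, hφ, hw, fun x => rfl, ?_, fun x => rfl, ?_⟩
  · rw [gradient_eq_diffOp]
    exact contDiff_diffOp _ hφ
  · exact contDiff_diffOp (crossMulTL n) hw
  · intro x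
    rw [hpdiv, hpcurl, gradient_vdiv_add_ncurlT_ncurl (contDiff_potential hn ha hsupp),
      laplacian_potential hn ha hsupp]
  · exact ncurl_gradient hφ
  · exact vdiv_ncurlT hw
  · exact integrable_green_smul hn hdiv.continuous hdivs
  · exact integrable_green_smul hn hcurl.continuous hcurls
  · intro x
    refine (integrable_gradKernel hn hdiv.continuous hdivs (gradSymbol n) x).congr
      (.of_forall fun y => ?_)
    simp only [gradSymbol_apply, gradKernel, smul_smul, mul_comm]
  · intro x
    refine (integrable_gradKernel hn hcurl.continuous hcurls (crossMulTL n) x).congr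
      (.of_forall fun y => ?_)
    simp only [gradKernel, ← crossMulTL_apply, map_smul, smul_apply]
  · intro x
    rw [gradient_eq_diffOp, diffOp_potential_eq_integral hn _ (hdiv.of_le h1) hdivs]
    simp only [gradSymbol_apply, gradKernel, smul_smul, mul_comm]
  · intro x
    rw [ncurlT_eq_diffOp, diffOp_potential_eq_integral hn _ (hcurl.of_le h1) hcurls]
    simp only [gradKernel, ← crossMulTL_apply, map_smul, smul_apply]
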